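/- Let $G=\langle a,b,c \mid [a,c],\,[b,c],\,[a,b]c^{-1}\rangle$ be the integral Heisenberg group $\mathcal H_3(\mathbb Z)$, where $[x,y]=xyx^{-1}y^{-1}$. For a finite presentation $\langle X\mid R\rangle$ of a group and a word $w$ on $X^{\pm1}$ that represents $1$, let $\mathrm{Area}(w)$ be the least $k$ such that $w$ is freely equal to a product of $k$ conjugates of elements of $R\cup R^{-1}$. For words $u,v$ that represent conjugate elements, let $\mathrm{Ann}(u,v)$ be the minimum of $\mathrm{Area}(\gamma u\gamma^{-1}v^{-1})$ over all words $\gamma$ such that $\gamma u\gamma^{-1}=v$ in the group. The annular Dehn function $\mathrm{Ann}:\mathbb N\to\mathbb N$ of the presentation sends $n$ to the maximum of $\mathrm{Ann}(u,v)$ over all pairs of words $u,v$ with $|u|+|v|\le n$ that represent conjugate elements. For $f,g:\mathbb N\to\mathbb N$ write $f\lesssim g$ if there is an integer $C>0$ such that $f(n)\le C\,g(Cn+n)+Cn+C$ for all $n$, and $f\simeq g$ if $f\lesssim g$ and $g\lesssim f$. Then for every finite presentation of $G$, in particular for the one above, the annular Dehn function satisfies $\mathrm{Ann}(n)\simeq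 n^4$. -/

import Mathlib

namespace AnnularDehn

/-- Words on `X` and formal inverses of elements of `X`, not necessarily reduced:
`(x, true)` stands for `x` and `(x, false)` for `x⁻¹`.  The length of a word is its list length. -/
abbrev Word (X : Type*) := List (X × Bool)

section Presentation

variable {X : Type*}

/-- The element of `⟨X ∣ R⟩` represented by a word. -/
def val (R : Set (FreeGroup X)) (w : Word X) : PresentedGroup R :=
  PresentedGroup.mk R (FreeGroup.mk w)

/-- `w` is equal in the free group to a product of `k` conjugates of elements of `R ∪ R⁻¹`. -/
def IsFilling (R : Set (FreeGroup X)) (w : FreeGroup X) (k : ℕ) : Prop :=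
  ∃ l : List (FreeGroup X), l.length = k ∧ l.prod = w ∧
    ∀ x ∈ l, ∃ g : FreeGroup X, ∃ r ∈ R, x = g * r * g⁻¹ ∨ x = g * r⁻¹ * g⁻¹

/-- `Area(w)`: the least `k` such that `w` freely equals a product of `k` conjugates of relators and
inverses of relators. Only used for `w` that represent `1` in `⟨X ∣ R⟩`. -/
noncomputable def area (R : Set (FreeGroup X)) (w : FreeGroup X) : ℕ :=
  sInf {k | IsFilling R w k}

/-- The area is a genuine minimum for every `w` that is trivial in `⟨X ∣ R⟩`. -/
theorem isFilling_area (R : Set (FreeGroup X)) (w : FreeGroup X)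
    (hw : PresentedGroup.mk R w = 1) : IsFilling R w (area R w) := by
  have hmem : w ∈ Subgroup.normalClosure R := (QuotientGroup.eq_one_iff w).1 hw
  refine Nat.sInf_mem (s := {k | IsFilling R w k}) ?_
  suffices h : ∃ k, IsFilling R w k from h
  refine Subgroup.closure_induction'' (p := fun w _ => ∃ k, IsFilling R w k) ?_ ?_ ?_ ?_ hmem
  · intro x hx
    obtain ⟨r, hr, hc⟩ := Group.mem_conjugatesOfSet_iff.1 hx
    obtain ⟨g, hg⟩ := isConj_iff.1 hc
    exact ⟨1, [x], rfl, by simp, by simpa using ⟨g, r, hr, Or.inl hg.symm⟩⟩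
  · intro x hx
    obtain ⟨r, hr, hc⟩ := Group.mem_conjugatesOfSet_iff.1 hx
    obtain ⟨g, hg⟩ := isConj_iff.1 hc
    refine ⟨1, [x⁻¹], rfl, by simp, ?_⟩
    simpa using ⟨g, r, hr, Or.inr (by rw [← hg]; group)⟩
  · exact ⟨0, [], rfl, by simp, by simp⟩
  · rintro x y - - ⟨_, l, -, hl, hl'⟩ ⟨_, m, -, hm, hm'⟩
    refine ⟨_, l ++ m, rfl, by simp [hl, hm], fun z hz => ?_⟩
    rcases List.mem_append.1 hz with h | h
    exacts [hl' z h, hm' z h]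

/-- `Ann(u, v)`: the minimum of `Area(γ u γ⁻¹ v⁻¹)` over all words `γ` such that `γ u γ⁻¹ = v` in
`⟨X ∣ R⟩`. Only used for `u` and `v` that represent conjugate elements. -/
noncomputable def annPair (R : Set (FreeGroup X)) (u v : Word X) : ℕ :=
  sInf {k | ∃ γ : Word X, val R γ * val R u * (val R γ)⁻¹ = val R v ∧
    k = area R (FreeGroup.mk γ * FreeGroup.mk u * (FreeGroup.mk γ)⁻¹ * (FreeGroup.mk v)⁻¹)}

/-- The values `Ann(u, v)` for pairs of words of total length at most `n` that represent conjugate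
elements. -/
def annValues (R : Set (FreeGroup X)) (n : ℕ) : Set ℕ :=
  {k | ∃ u v : Word X, u.length + v.length ≤ n ∧ IsConj (val R u) (val R v) ∧ k = annPair R u v}

/-- The annular Dehn function of the presentation `⟨X ∣ R⟩`. -/
noncomputable def ann (R : Set (FreeGroup X)) (n : ℕ) : ℕ :=
  sSup (annValues R n)

/-- If `X` is finite, the annular Dehn function is a genuine maximum. -/
theorem isGreatest_ann [Finite X] (R : Set (FreeGroup X)) (n : ℕ) :
    IsGreatest (annValues R n) (ann R n) := by
  have hfin : (annValues R n).Finite := by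
    have h := List.finite_length_le (X × Bool) n
    refine ((h.prod h).image fun p => annPair R p.1 p.2).subset ?_
    rintro k ⟨u, v, hl, -, rfl⟩
    exact ⟨(u, v), ⟨show u.length ≤ n by omega, show v.length ≤ n by omega⟩, rfl⟩
  have hne : (annValues R n).Nonempty :=
    ⟨_, [], [], by simp, IsConj.refl _, rfl⟩
  exact ⟨Nat.sSup_mem hne hfin.bddAbove, fun k hk => le_csSup hfin.bddAbove hk⟩

end Presentation

/-- `f ≲ g`: there is a constant `C > 0` with `f(n) ≤ C g(Cn + n) + Cn + C` for all `n`. -/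
def Dominated (f g : ℕ → ℕ) : Prop :=
  ∃ C : ℕ, 0 < C ∧ ∀ n : ℕ, f n ≤ C * g (C * n + n) + C * n + C

/-- `f ≃ g`: both `f ≲ g` and `g ≲ f`. -/
def Equivalent (f g : ℕ → ℕ) : Prop :=
  Dominated f g ∧ Dominated g f

/-- The three generators `a`, `b`, `c` of the integral Heisenberg group. -/
inductive HGen : Type
  | a
  | b
  | c

open FreeGroup in
/-- The relators `[a, c]`, `[b, c]` and `[a, b] c⁻¹`, where `[x, y] = x y x⁻¹ y⁻¹`. -/
def heisenbergRels : Set (FreeGroup HGen) :=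
  {of HGen.a * of HGen.c * (of HGen.a)⁻¹ * (of HGen.c)⁻¹,
   of HGen.b * of HGen.c * (of HGen.b)⁻¹ * (of HGen.c)⁻¹,
   of HGen.a * of HGen.b * (of HGen.a)⁻¹ * (of HGen.b)⁻¹ * (of HGen.c)⁻¹}

/-- The integral Heisenberg group `⟨a, b, c ∣ [a, c], [b, c], [a, b] c⁻¹⟩`. -/
abbrev Heisenberg : Type := PresentedGroup heisenbergRels

end AnnularDehn

/-! With d = c⁻¹ the relations say that ba = abd with d central, and every element has a normal form
a^x b^y d^z.

Upper bound: a word of length n has exponents x, y = O(n) and z = O(n²), and reaches its normal form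
with O(n³) relators (`HeisTriple.exists_normalForm`). If (p, q, z) and (p, q, z') are conjugate,
then a^s b^t is a conjugator as soon as tp - sq = z' - z. This equation has a solution with s, t,
tp, sq all O(n²) (`exists_bounded_solution`). Exchanging b^y with a^s costs O(|ys|(|y| + |s|))
relators, so the products involved cost O(n⁴).

Lower bound: b^(n²) conjugates a to a word of length O(n), and every conjugator has b-exponent n².
In the central extension `Engel`, conjugating a by b^t moves the central coordinate by t². On words
trivial in the group that coordinate is at most linear in the area (`exists_engel_lift`), while here
it is n⁴ - n³ whatever the conjugator (`Engel.conj_defect`).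

Both bounds work with lifts of a, b, d to the free group of an arbitrary finite presentation, so
invariance of the annular Dehn function is not needed. -/

namespace AnnularDehn

/-! ### Fillings, and equality up to a bounded number of relators. -/

section Fillings

variable {X : Type*} {R : Set (FreeGroup X)}

theorem IsFilling.one : IsFilling R 1 0 := ⟨[], rfl, rfl, by simp⟩

theorem IsFilling.mul {x y : FreeGroup X} {j k : ℕ} (hx : IsFilling R x j)
    (hy : IsFilling R y k) : IsFilling R (x * y) (j + k) := by
  obtain ⟨l, rfl, rfl, hl⟩ := hx
  obtain ⟨m, rfl, rfl, hm⟩ := hy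
  refine ⟨l ++ m, by simp, by simp, fun z hz => ?_⟩
  rcases List.mem_append.1 hz with h | h
  exacts [hl z h, hm z h]

theorem IsFilling.conj {x : FreeGroup X} {k : ℕ} (hx : IsFilling R x k) (g : FreeGroup X) :
    IsFilling R (g * x * g⁻¹) k := by
  obtain ⟨l, rfl, rfl, hl⟩ := hx
  refine ⟨l.map (MulAut.conj g), by simp, ?_, fun z hz => ?_⟩
  · rw [← map_list_prod, MulAut.conj_apply]
  · obtain ⟨y, hy, rfl⟩ := List.mem_map.1 hz
    obtain ⟨h, r, hr, e | e⟩ := hl y hy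
    · exact ⟨g * h, r, hr, Or.inl (by rw [e, MulAut.conj_apply]; group)⟩
    · exact ⟨g * h, r, hr, Or.inr (by rw [e, MulAut.conj_apply]; group)⟩

theorem IsFilling.inv {x : FreeGroup X} {k : ℕ} (hx : IsFilling R x k) :
    IsFilling R x⁻¹ k := by
  obtain ⟨l, rfl, rfl, hl⟩ := hx
  refine ⟨(l.map fun y => y⁻¹).reverse, by simp, by rw [List.prod_inv_reverse], fun z hz => ?_⟩
  obtain ⟨y, hy, rfl⟩ := List.mem_map.1 (List.mem_reverse.1 hz)
  obtain ⟨h, r, hr, e | e⟩ := hl y hy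
  · exact ⟨h, r, hr, Or.inr (by rw [e]; group)⟩
  · exact ⟨h, r, hr, Or.inl (by rw [e]; group)⟩

theorem IsFilling.of_mem {r : FreeGroup X} (hr : r ∈ R) : IsFilling R r 1 :=
  ⟨[r], rfl, by simp, by simpa using ⟨1, r, hr, Or.inl (by simp)⟩⟩

theorem IsFilling.mk_eq_one {x : FreeGroup X} {k : ℕ} (hx : IsFilling R x k) :
    PresentedGroup.mk R x = 1 := by
  obtain ⟨l, -, rfl, hl⟩ := hx
  rw [map_list_prod]
  refine List.prod_eq_one fun z hz => ?_
  obtain ⟨y, hy, rfl⟩ := List.mem_map.1 hz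
  obtain ⟨h, r, hr, e | e⟩ := hl y hy <;> simp [e, PresentedGroup.one_of_mem hr]

/-- `x` and `y` differ in the free group by a product of at most `k` conjugates of relators and
inverses of relators. -/
def Within (R : Set (FreeGroup X)) (k : ℕ) (x y : FreeGroup X) : Prop :=
  ∃ j ≤ k, IsFilling R (x * y⁻¹) j

namespace Within

variable {j k : ℕ} {x y z x' y' g : FreeGroup X}

theorem refl (R : Set (FreeGroup X)) (k : ℕ) (x : FreeGroup X) : Within R k x x :=
  ⟨0, Nat.zero_le _, by simpa using IsFilling.one⟩

theorem of_eq (h : x = y) : Within R k x y := h ▸ refl R k x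

theorem mono (h : Within R j x y) (hjk : j ≤ k) : Within R k x y :=
  let ⟨i, hi, hf⟩ := h
  ⟨i, hi.trans hjk, hf⟩

theorem symm (h : Within R k x y) : Within R k y x := by
  obtain ⟨i, hi, hf⟩ := h
  exact ⟨i, hi, by simpa using hf.inv⟩

theorem trans (h : Within R j x y) (h' : Within R k y z) : Within R (j + k) x z := by
  obtain ⟨i, hi, hf⟩ := h
  obtain ⟨i', hi', hf'⟩ := h'
  exact ⟨i + i', by omega, by simpa using hf.mul hf'⟩

theorem mul_left (g : FreeGroup X) (h : Within R k x y) : Within R k (g * x) (g * y) := by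
  obtain ⟨i, hi, hf⟩ := h
  refine ⟨i, hi, ?_⟩
  convert hf.conj g using 1
  group

theorem mul_right (g : FreeGroup X) (h : Within R k x y) : Within R k (x * g) (y * g) := by
  obtain ⟨i, hi, hf⟩ := h
  refine ⟨i, hi, ?_⟩
  convert hf using 1
  group

theorem mul (h : Within R j x y) (h' : Within R k x' y') :
    Within R (j + k) (x * x') (y * y') :=
  (h.mul_right x').trans (h'.mul_left y)

theorem mk_eq (h : Within R k x y) : PresentedGroup.mk R x = PresentedGroup.mk R y := by
  obtain ⟨i, -, hf⟩ := h
  have := hf.mk_eq_one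
  rwa [map_mul, map_inv, mul_inv_eq_one] at this

/-- Gives no control on the cost; this is enough for finitely many relations fixed once and for all.
-/
theorem of_mk_eq (h : PresentedGroup.mk R x = PresentedGroup.mk R y) : ∃ k, Within R k x y :=
  ⟨_, _, le_rfl, isFilling_area R (x * y⁻¹) (by rw [map_mul, map_inv, h, mul_inv_cancel])⟩

theorem area_le (h : Within R k x y) : area R (x * y⁻¹) ≤ k := by
  obtain ⟨i, hi, hf⟩ := h
  exact (Nat.sInf_le hf).trans hi

/-- Multiply both sides by fixed elements and rewrite the results. -/
theorem congr (h : Within R k x y) (g g' : FreeGroup X) (hx : g * x * g' = x')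
    (hy : g * y * g' = y') : Within R k x' y' := by
  subst hx hy
  exact (h.mul_left g).mul_right g'

theorem comm_inv_left (h : Within R k (x * y) (y * x)) :
    Within R k (x⁻¹ * y) (y * x⁻¹) :=
  (h.congr x⁻¹ x⁻¹ (x' := y * x⁻¹) (y' := x⁻¹ * y) (by group) (by group)).symm

theorem comm_pow_left (h : Within R k (x * y) (y * x)) (n : ℕ) :
    Within R (k * n) (x ^ n * y) (y * x ^ n) := by
  induction n with
  | zero => exact of_eq (by simp)
  | succ n ih =>
    have h1 : Within R k (x ^ (n + 1) * y) (x ^ n * y * x) :=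
      h.congr (x ^ n) 1 (by rw [pow_succ]; group) (by group)
    refine ((h1.trans (ih.mul_right x)).trans (of_eq (k := 0) ?_)).mono (by rw [mul_add]; omega)
    rw [pow_succ]; group

theorem comm_zpow_left (h : Within R k (x * y) (y * x)) (m : ℤ) :
    Within R (k * m.natAbs) (x ^ m * y) (y * x ^ m) := by
  obtain ⟨n, rfl | rfl⟩ := m.eq_nat_or_neg
  · simpa using h.comm_pow_left n
  · simpa using h.comm_inv_left.comm_pow_left n

theorem comm_zpow (h : Within R k (x * y) (y * x)) (m n : ℤ) :
    Within R (k * m.natAbs * n.natAbs) (x ^ m * y ^ n) (y ^ n * x ^ m) :=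
  ((h.comm_zpow_left m).symm.comm_zpow_left n).symm

end Within

/-! ### The cost of computing with normal forms. -/

/-- Elements `a`, `b`, `d` of the free group that satisfy the Heisenberg relations `ba = abd`,
`ad = da`, `bd = db` modulo `R`, each of them at a cost of at most `K` relators. -/
structure HeisTriple (R : Set (FreeGroup X)) (K : ℕ) (a b d : FreeGroup X) : Prop where
  swap : Within R K (b * a) (a * b * d)
  comm_a : Within R K (d * a) (a * d)
  comm_b : Within R K (d * b) (b * d)

namespace HeisTriple

variable {K : ℕ} {a b d : FreeGroup X}

/-- Inverting one of a, b inverts their commutator up to central corrections. This reduces integer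
exponents to natural ones, at the price of doubling `K` for each sign. -/
theorem inv_a (h : HeisTriple R K a b d) : HeisTriple R (2 * K) a⁻¹ b d⁻¹ where
  swap := by
    have h1 : Within R K (a⁻¹ * b * d⁻¹) (b * d * a⁻¹ * d⁻¹) :=
      h.swap.congr a⁻¹ (a⁻¹ * d⁻¹) (by group) (by group)
    have h2 : Within R K (b * a⁻¹) (b * d * a⁻¹ * d⁻¹) :=
      h.comm_a.congr (b * a⁻¹) (a⁻¹ * d⁻¹) (by group) (by group)
    exact (h2.trans h1.symm).mono (by omega)
  comm_a := (h.comm_a.symm.comm_inv_left.symm.comm_inv_left).mono (by omega)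
  comm_b := h.comm_b.comm_inv_left.mono (by omega)

theorem inv_b (h : HeisTriple R K a b d) : HeisTriple R (2 * K) a b⁻¹ d⁻¹ where
  swap := by
    have h1 : Within R K (b⁻¹ * a) (a * d⁻¹ * b⁻¹) :=
      (h.swap.congr b⁻¹ (d⁻¹ * b⁻¹) (by group) (by group)).symm
    have h2 : Within R K (a * d⁻¹ * b⁻¹) (a * b⁻¹ * d⁻¹) :=
      h.comm_b.congr (a * d⁻¹ * b⁻¹) (b⁻¹ * d⁻¹) (by group) (by group)
    exact (h1.trans h2).mono (by omega)
  comm_a := h.comm_a.comm_inv_left.mono (by omega)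
  comm_b := (h.comm_b.symm.comm_inv_left.symm.comm_inv_left).mono (by omega)

/-- Each further a passes d^s at cost `K * s` and then b at cost `K`, and s + 1 ≤ 2s + 1. -/
theorem swap_pow_right (h : HeisTriple R K a b d) (s : ℕ) :
    Within R (K * s ^ 2) (b * a ^ s) (a ^ s * b * d ^ s) := by
  induction s with
  | zero => exact Within.of_eq (by simp)
  | succ s ih =>
    have h1 : Within R (K * s ^ 2) (b * a ^ (s + 1)) (a ^ s * b * d ^ s * a) :=
      ih.congr 1 a (by rw [pow_succ]; group) (by group)
    have h2 : Within R (K * s) (a ^ s * b * d ^ s * a) (a ^ s * b * a * d ^ s) :=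
      (h.comm_a.comm_pow_left s).congr (a ^ s * b) 1 (by group) (by group)
    have h3 : Within R K (a ^ s * b * a * d ^ s) (a ^ (s + 1) * b * d ^ (s + 1)) :=
      h.swap.congr (a ^ s) (d ^ s) (by group) (by rw [pow_succ, pow_succ']; group)
    refine ((h1.trans h2).trans h3).mono ?_
    nlinarith

/-- One more b passes a^s at cost `K * s ^ 2`, and the d^s so produced passes b^y at cost `K * s *
y`. Keeping the factor ys in the bound is essential: exponents of size n² occur later, but only with
ys = O(n²). -/
theorem swap_pow (h : HeisTriple R K a b d) (y s : ℕ) :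
    Within R (K * (y * s * (y + s))) (b ^ y * a ^ s) (a ^ s * b ^ y * d ^ (y * s)) := by
  induction y with
  | zero => exact Within.of_eq (by simp)
  | succ y ih =>
    have h1 := ih.congr b 1 (x' := b ^ (y + 1) * a ^ s)
      (y' := b * a ^ s * b ^ y * d ^ (y * s)) (by rw [pow_succ']; group) (by group)
    have h2 := ((h.swap_pow_right s).mul_right (b ^ y)).mul_right (d ^ (y * s))
    have h3 := ((h.comm_b.comm_pow_left s).symm.comm_pow_left y).symm.congr (a ^ s * b)
      (d ^ (y * s))
      (x' := a ^ s * b * d ^ s * b ^ y * d ^ (y * s))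
      (y' := a ^ s * b ^ (y + 1) * d ^ ((y + 1) * s)) (by group)
      (by rw [pow_succ', add_mul, one_mul, add_comm, pow_add]; group)
    exact ((h1.trans h2).trans h3).mono (Nat.le.intro (k := K * (y * s + s)) (by ring))

theorem swap_zpow (h : HeisTriple R K a b d) (y s : ℤ) :
    Within R (4 * K * (y.natAbs * s.natAbs * (y.natAbs + s.natAbs))) (b ^ y * a ^ s)
      (a ^ s * b ^ y * d ^ (y * s)) := by
  obtain ⟨m, rfl | rfl⟩ := y.eq_nat_or_neg <;> obtain ⟨n, rfl | rfl⟩ := s.eq_nat_or_neg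
  · have := (h.swap_pow m n).mono (k := 4 * K * (m * n * (m + n)))
      (Nat.mul_le_mul_right _ (by omega))
    simpa only [Int.natAbs_neg, Int.natAbs_natCast, zpow_neg, zpow_natCast, inv_zpow, inv_pow,
      neg_mul, mul_neg, neg_neg, inv_inv, ← Nat.cast_mul] using this
  · have := (h.inv_a.swap_pow m n).mono (k := 4 * K * (m * n * (m + n)))
      (Nat.mul_le_mul_right _ (by omega))
    simpa only [Int.natAbs_neg, Int.natAbs_natCast, zpow_neg, zpow_natCast, inv_zpow, inv_pow,
      neg_mul, mul_neg, neg_neg, inv_inv, ← Nat.cast_mul] using this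
  · have := (h.inv_b.swap_pow m n).mono (k := 4 * K * (m * n * (m + n)))
      (Nat.mul_le_mul_right _ (by omega))
    simpa only [Int.natAbs_neg, Int.natAbs_natCast, zpow_neg, zpow_natCast, inv_zpow, inv_pow,
      neg_mul, mul_neg, neg_neg, inv_inv, ← Nat.cast_mul] using this
  · have := (h.inv_a.inv_b.swap_pow m n).mono (k := 4 * K * (m * n * (m + n)))
      (Nat.mul_le_mul_right _ (by omega))
    simpa only [Int.natAbs_neg, Int.natAbs_natCast, zpow_neg, zpow_natCast, inv_zpow, inv_pow,
      neg_mul, mul_neg, neg_neg, inv_inv, ← Nat.cast_mul] using this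

/-- Multiplication of normal forms, with its cost. -/
theorem normalForm_mul (h : HeisTriple R K a b d) (x y z i j k : ℤ) :
    Within R (K * (z.natAbs * (i.natAbs + j.natAbs)
        + 4 * (y.natAbs * i.natAbs * (y.natAbs + i.natAbs)) + y.natAbs * i.natAbs * j.natAbs))
      (a ^ x * b ^ y * d ^ z * (a ^ i * b ^ j * d ^ k))
      (a ^ (x + i) * b ^ (y + j) * d ^ (z + k + y * i)) := by
  have h1 := (h.comm_a.comm_zpow z i).congr (a ^ x * b ^ y) (b ^ j * d ^ k)
    (x' := a ^ x * b ^ y * d ^ z * (a ^ i * b ^ j * d ^ k))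
    (y' := a ^ x * b ^ y * a ^ i * d ^ z * b ^ j * d ^ k) (by group) (by group)
  have h2 := (h.comm_b.comm_zpow z j).congr (a ^ x * b ^ y * a ^ i) (d ^ k)
    (x' := a ^ x * b ^ y * a ^ i * d ^ z * b ^ j * d ^ k)
    (y' := a ^ x * b ^ y * a ^ i * b ^ j * d ^ (z + k)) (by group) (by group)
  have h3 := (h.swap_zpow y i).congr (a ^ x) (b ^ j * d ^ (z + k))
    (x' := a ^ x * b ^ y * a ^ i * b ^ j * d ^ (z + k))
    (y' := a ^ (x + i) * b ^ y * d ^ (y * i) * b ^ j * d ^ (z + k)) (by group) (by group)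
  have h4 := (h.comm_b.comm_zpow (y * i) j).congr (a ^ (x + i) * b ^ y) (d ^ (z + k))
    (x' := a ^ (x + i) * b ^ y * d ^ (y * i) * b ^ j * d ^ (z + k))
    (y' := a ^ (x + i) * b ^ (y + j) * d ^ (z + k + y * i)) (by group) (by group)
  refine (((h1.trans h2).trans h3).trans h4).mono (le_of_eq ?_)
  rw [Int.natAbs_mul]
  ring

/-- A word of length `n` is brought to normal form with `O(n ^ 3)` relators. -/
theorem exists_normalForm (h : HeisTriple R K a b d) {B : ℕ} (hB : 1 ≤ B)
    (hgen : ∀ l : X × Bool, ∃ i j k : ℤ, i.natAbs ≤ B ∧ j.natAbs ≤ B ∧ k.natAbs ≤ B ∧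
      Within R K (FreeGroup.mk [l]) (a ^ i * b ^ j * d ^ k)) (w : Word X) :
    ∃ x y z : ℤ, x.natAbs ≤ B * w.length ∧ y.natAbs ≤ B * w.length ∧
      z.natAbs ≤ (B * w.length) ^ 2 ∧
      Within R (8 * K * B ^ 3 * w.length ^ 3) (FreeGroup.mk w) (a ^ x * b ^ y * d ^ z) := by
  induction w using List.reverseRecOn with
  | nil => exact ⟨0, 0, 0, by simp, by simp, by simp, Within.of_eq (by simp [FreeGroup.one_eq_mk])⟩
  | append_singleton w l ih =>
    obtain ⟨x, y, z, hx, hy, hz, hw⟩ := ih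
    obtain ⟨i, j, k, hi, hj, hk, hl⟩ := hgen l
    set n := w.length
    have hlen : (w ++ [l]).length = n + 1 := by simp [n]
    have hyi : (y * i).natAbs ≤ B * n * B := by
      rw [Int.natAbs_mul]; exact Nat.mul_le_mul hy hi
    rw [hlen]
    refine ⟨x + i, y + j, z + k + y * i, ?_, ?_, ?_, ?_⟩
    · have := Int.natAbs_add_le x i; rw [mul_add]; omega
    · have := Int.natAbs_add_le y j; rw [mul_add]; omega
    · have h1 := Int.natAbs_add_le (z + k) (y * i)
      have h2 := Int.natAbs_add_le z k
      have h3 : B ≤ B ^ 2 := Nat.le_self_pow (by norm_num) B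
      have h4 : (B * (n + 1)) ^ 2 = (B * n) ^ 2 + 2 * (B * n * B) + B ^ 2 := by ring
      omega
    · rw [← FreeGroup.mul_mk]
      refine ((hw.mul hl).trans (h.normalForm_mul x y z i j k)).mono ?_
      have e1 : z.natAbs * (i.natAbs + j.natAbs) ≤ (B * n) ^ 2 * (B + B) := by gcongr
      have e2 : y.natAbs * i.natAbs * (y.natAbs + i.natAbs) ≤ B * n * B * (B * n + B) := by gcongr
      have e3 : y.natAbs * i.natAbs * j.natAbs ≤ B * n * B * B := by gcongr
      -- The last summand 1 in `e5` pays for rewriting the new letter by `hl`.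
      have e4 : 1 ≤ B ^ 3 := Nat.one_le_pow _ _ hB
      have e5 : z.natAbs * (i.natAbs + j.natAbs)
          + 4 * (y.natAbs * i.natAbs * (y.natAbs + i.natAbs)) + y.natAbs * i.natAbs * j.natAbs + 1
          ≤ B ^ 3 * (6 * n ^ 2 + 5 * n + 1) := by nlinarith
      have e6 : B ^ 3 * (6 * n ^ 2 + 5 * n + 1) ≤ B ^ 3 * (8 * (3 * n ^ 2 + 3 * n + 1)) :=
        Nat.mul_le_mul_left _ (by nlinarith)
      calc _ = 8 * K * B ^ 3 * n ^ 3 + K * (z.natAbs * (i.natAbs + j.natAbs)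
          + 4 * (y.natAbs * i.natAbs * (y.natAbs + i.natAbs))
          + y.natAbs * i.natAbs * j.natAbs + 1) := by ring
        _ ≤ 8 * K * B ^ 3 * n ^ 3 + K * (B ^ 3 * (8 * (3 * n ^ 2 + 3 * n + 1))) := by
          gcongr; exact e5.trans e6
        _ = _ := by ring

end HeisTriple

end Fillings

/-! ### The size of a conjugator. -/

/-- Bounded solutions of a solvable linear equation in two unknowns. -/
theorem exists_bounded_solution {p q D s₀ t₀ : ℤ} {m : ℕ} (hp : p.natAbs ≤ m)
    (hq : q.natAbs ≤ m) (hD : D.natAbs ≤ 2 * m ^ 2) (h₀ : t₀ * p - s₀ * q = D) :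
    ∃ s t : ℤ, t * p - s * q = D ∧ s.natAbs ≤ 3 * m ^ 2 ∧ t.natAbs ≤ 3 * m ^ 2 ∧
      (t * p).natAbs ≤ 3 * m ^ 2 ∧ (s * q).natAbs ≤ 3 * m ^ 2 := by
  by_cases hp0 : p = 0
  · subst hp0
    by_cases hq0 : q = 0
    · subst hq0
      exact ⟨0, 0, by simpa using h₀, by simp, by simp, by simp, by simp⟩
    · have h1 : (s₀ * q).natAbs = D.natAbs := by rw [← h₀]; simp
      have h2 : s₀.natAbs ≤ (s₀ * q).natAbs := by
        rw [Int.natAbs_mul]; exact Nat.le_mul_of_pos_right _ (Int.natAbs_pos.2 hq0)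
      exact ⟨s₀, 0, by simpa using h₀, by omega, by simp, by simp, by omega⟩
  · have hs := Int.emod_nonneg s₀ hp0
    have hs' := Int.emod_lt_abs s₀ hp0
    rw [Int.abs_eq_natAbs] at hs'
    have hsm : (s₀ % p).natAbs ≤ m := by omega
    have hmm : m ≤ m ^ 2 := Nat.le_self_pow (by norm_num) m
    have hsq : (s₀ % p * q).natAbs ≤ m ^ 2 := by
      rw [Int.natAbs_mul, sq]; exact Nat.mul_le_mul hsm hq
    have heq : (t₀ - q * (s₀ / p)) * p - s₀ % p * q = D := by
      rw [← h₀, Int.emod_def]; ring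
    have htp : ((t₀ - q * (s₀ / p)) * p).natAbs ≤ 3 * m ^ 2 := by omega
    have ht : (t₀ - q * (s₀ / p)).natAbs ≤ ((t₀ - q * (s₀ / p)) * p).natAbs := by
      rw [Int.natAbs_mul]; exact Nat.le_mul_of_pos_right _ (Int.natAbs_pos.2 hp0)
    exact ⟨_, _, heq, by omega, by omega, htp, by omega⟩

/-! ### The Heisenberg group and a central extension in coordinates. -/

/-- Coordinates on the integral Heisenberg group, as `ℤ² ⋊ ℤ`. -/
@[ext]
structure Heis : Type where
  p : ℤ
  q : ℤ
  t : ℤ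

namespace Heis

instance : Mul Heis := ⟨fun g h => ⟨g.p + h.p, g.q + h.q + g.t * h.p, g.t + h.t⟩⟩

instance : One Heis := ⟨⟨0, 0, 0⟩⟩

instance : Inv Heis := ⟨fun g => ⟨-g.p, -(g.q - g.t * g.p), -g.t⟩⟩

theorem mul_def (g h : Heis) : g * h = ⟨g.p + h.p, g.q + h.q + g.t * h.p, g.t + h.t⟩ := rfl

theorem one_def : (1 : Heis) = ⟨0, 0, 0⟩ := rfl

theorem inv_def (g : Heis) : g⁻¹ = ⟨-g.p, -(g.q - g.t * g.p), -g.t⟩ := rfl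

instance : Group Heis :=
  Group.ofLeftAxioms
    (fun g h k => by ext <;> simp only [mul_def] <;> ring)
    (fun g => by ext <;> simp [mul_def, one_def])
    (fun g => by ext <;> simp only [mul_def, one_def, inv_def] <;> ring)

theorem zpow_p (n : ℤ) : (⟨1, 0, 0⟩ : Heis) ^ n = ⟨n, 0, 0⟩ := by
  induction n with
  | zero => rfl
  | succ n ih => rw [zpow_add_one, ih]; ext <;> simp [mul_def]
  | pred n ih => rw [zpow_sub_one, ih]; ext <;> simp [mul_def, inv_def]; ring

theorem zpow_q (n : ℤ) : (⟨0, 1, 0⟩ : Heis) ^ n = ⟨0, n, 0⟩ := by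
  induction n with
  | zero => rfl
  | succ n ih => rw [zpow_add_one, ih]; ext <;> simp [mul_def]
  | pred n ih => rw [zpow_sub_one, ih]; ext <;> simp [mul_def, inv_def]; ring

theorem zpow_t (n : ℤ) : (⟨0, 0, 1⟩ : Heis) ^ n = ⟨0, 0, n⟩ := by
  induction n with
  | zero => rfl
  | succ n ih => rw [zpow_add_one, ih]; ext <;> simp [mul_def]
  | pred n ih => rw [zpow_sub_one, ih]; ext <;> simp [mul_def, inv_def]; ring

theorem normalForm (x y z : ℤ) :
    (⟨1, 0, 0⟩ : Heis) ^ x * ⟨0, 0, 1⟩ ^ y * ⟨0, 1, 0⟩ ^ z = ⟨x, z, y⟩ := by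
  rw [zpow_p, zpow_q, zpow_t]
  ext <;> simp [mul_def]

theorem eq_of_isConj {x y z x' y' z' : ℤ} (h : IsConj (⟨x, z, y⟩ : Heis) ⟨x', z', y'⟩) :
    x = x' ∧ y = y' ∧ ∃ s t : ℤ, t * x - s * y = z' - z := by
  obtain ⟨⟨s, r, t⟩, hg⟩ := isConj_iff.1 h
  rw [mul_inv_eq_iff_eq_mul, Heis.ext_iff] at hg
  simp only [mul_def] at hg
  obtain ⟨h1, h2, h3⟩ := hg
  obtain rfl : x = x' := by linarith
  obtain rfl : y = y' := by linarith
  exact ⟨rfl, rfl, s, t, by linarith⟩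

end Heis

/-- A nilpotent group of class three, as `ℤ³ ⋊ ℤ`. It is a central extension of `Heis`. -/
@[ext]
structure Engel : Type where
  p : ℤ
  q : ℤ
  r : ℤ
  t : ℤ

namespace Engel

instance : Mul Engel :=
  ⟨fun g h => ⟨g.p + h.p, g.q + h.q + g.t * h.p,
    g.r + h.r + 2 * g.t * h.q + g.t ^ 2 * h.p, g.t + h.t⟩⟩

instance : One Engel := ⟨⟨0, 0, 0, 0⟩⟩

instance : Inv Engel :=
  ⟨fun g => ⟨-g.p, -(g.q - g.t * g.p), -(g.r - 2 * g.t * g.q + g.t ^ 2 * g.p), -g.t⟩⟩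

theorem mul_def (g h : Engel) : g * h = ⟨g.p + h.p, g.q + h.q + g.t * h.p,
    g.r + h.r + 2 * g.t * h.q + g.t ^ 2 * h.p, g.t + h.t⟩ := rfl

theorem one_def : (1 : Engel) = ⟨0, 0, 0, 0⟩ := rfl

theorem inv_def (g : Engel) : g⁻¹ =
    ⟨-g.p, -(g.q - g.t * g.p), -(g.r - 2 * g.t * g.q + g.t ^ 2 * g.p), -g.t⟩ := rfl

instance : Group Engel :=
  Group.ofLeftAxioms
    (fun g h k => by ext <;> simp only [mul_def] <;> ring)
    (fun g => by ext <;> simp [mul_def, one_def])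
    (fun g => by ext <;> simp only [mul_def, one_def, inv_def] <;> ring)

/-- The quotient by the centre. -/
def toHeis : Engel →* Heis where
  toFun g := ⟨g.p, g.q, g.t⟩
  map_one' := rfl
  map_mul' _ _ := rfl

theorem eq_of_toHeis_eq_one {g : Engel} (h : toHeis g = 1) : g = ⟨0, 0, g.r, 0⟩ := by
  obtain ⟨h1, h2, h3⟩ := Heis.ext_iff.1 h
  ext
  exacts [h1, h2, rfl, h3]

/-- The coordinate `l` stays free because the lift of a is known only modulo the centre. -/
theorem pow_p (l : ℤ) (n : ℕ) : (⟨1, 0, l, 0⟩ : Engel) ^ n = ⟨n, 0, n * l, 0⟩ := by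
  induction n with
  | zero => simp [one_def]
  | succ n ih => rw [pow_succ, ih]; ext <;> simp [mul_def]; ring

theorem pow_t (l : ℤ) (n : ℕ) : (⟨0, 0, l, 1⟩ : Engel) ^ n = ⟨0, 0, n * l, n⟩ := by
  induction n with
  | zero => simp [one_def]
  | succ n ih => rw [pow_succ, ih]; ext <;> simp [mul_def]; ring

/-- If `g` conjugates `a` to `bⁿ aⁿ b⁻ⁿ a⁻ⁿ a` modulo the centre, then the two sides differ by
`n ^ 4 - n ^ 3` in the central coordinate. -/
theorem conj_defect (g : Engel) (l l' : ℤ) (n : ℕ)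
    (h : toHeis (g * ⟨1, 0, l, 0⟩ * g⁻¹) = toHeis ((⟨0, 0, l', 1⟩ : Engel) ^ n *
      ⟨1, 0, l, 0⟩ ^ n * (⟨0, 0, l', 1⟩ ^ n)⁻¹ * (⟨1, 0, l, 0⟩ ^ n)⁻¹ * ⟨1, 0, l, 0⟩)) :
    (g * ⟨1, 0, l, 0⟩ * g⁻¹ * ((⟨0, 0, l', 1⟩ : Engel) ^ n *
      ⟨1, 0, l, 0⟩ ^ n * (⟨0, 0, l', 1⟩ ^ n)⁻¹ * (⟨1, 0, l, 0⟩ ^ n)⁻¹ * ⟨1, 0, l, 0⟩)⁻¹).r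
      = n ^ 4 - n ^ 3 := by
  obtain ⟨p, q, r, t⟩ := g
  rw [pow_p, pow_t] at *
  simp only [mul_def, inv_def, toHeis, MonoidHom.coe_mk, OneHom.coe_mk, Heis.ext_iff] at h ⊢
  obtain ⟨-, h, -⟩ := h
  -- The part ℤ³ of `g` commutes with a, so only `t` matters, and the second coordinate of `h`
  -- forces it. The central coordinates are then l + t² = l + n⁴ on one side and l + n³ on the
  -- other.
  have ht : t = n ^ 2 := by linear_combination h
  subst ht
  ring

end Engel

/-! ### The lower bound. -/

section Lower

variable {X : Type*} {R : Set (FreeGroup X)}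

/-- A homomorphism to the Heisenberg group lifts to the free group, and the central coordinate of
the lift is bounded by a multiple of the area. -/
theorem exists_engel_lift (hR : R.Finite) (Φ : PresentedGroup R →* Heis) :
    ∃ (φ : FreeGroup X →* Engel) (M : ℕ),
      (∀ w, Engel.toHeis (φ w) = Φ (PresentedGroup.mk R w)) ∧
      ∀ w k, IsFilling R w k → (φ w).r.natAbs ≤ M * k := by
  let φ : FreeGroup X →* Engel := FreeGroup.lift fun x =>
    let h := Φ (PresentedGroup.of x)
    ⟨h.p, h.q, 0, h.t⟩
  have hφ : ∀ w, Engel.toHeis (φ w) = Φ (PresentedGroup.mk R w) := by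
    intro w
    have : Engel.toHeis.comp φ = Φ.comp (PresentedGroup.mk R) := by
      ext x <;> simp [φ, Engel.toHeis, PresentedGroup.of]
    exact DFunLike.congr_fun this w
  obtain ⟨M, hM⟩ := (hR.image fun r => (φ r).r.natAbs).bddAbove
  refine ⟨φ, M, hφ, ?_⟩
  -- Relators die in `Heis`, so `φ` sends them to the centre, where conjugation does nothing and
  -- coordinates add up.
  have hrel : ∀ r ∈ R, φ r = ⟨0, 0, (φ r).r, 0⟩ := fun r hr =>
    Engel.eq_of_toHeis_eq_one (by rw [hφ, PresentedGroup.one_of_mem hr, map_one])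
  rintro w k ⟨l, rfl, rfl, hl⟩
  suffices h : ∃ z : ℤ, z.natAbs ≤ M * l.length ∧ φ l.prod = ⟨0, 0, z, 0⟩ by
    obtain ⟨z, hz, e⟩ := h
    rwa [e]
  induction l with
  | nil => exact ⟨0, by simp, by simp [Engel.one_def]⟩
  | cons x l ih =>
    obtain ⟨z, hz, e⟩ := ih fun y hy => hl y (List.mem_cons_of_mem _ hy)
    obtain ⟨g, r, hr, hx⟩ := hl x List.mem_cons_self
    have hb : (φ r).r.natAbs ≤ M := hM ⟨r, hr, rfl⟩
    have hx' : ∃ z : ℤ, z.natAbs ≤ M ∧ φ x = ⟨0, 0, z, 0⟩ := by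
      rcases hx with rfl | rfl
      · refine ⟨(φ r).r, hb, ?_⟩
        rw [map_mul, map_mul, map_inv, mul_inv_eq_iff_eq_mul, hrel r hr]
        ext <;> simp [Engel.mul_def, add_comm]
      · refine ⟨-(φ r).r, by simpa using hb, ?_⟩
        rw [map_mul, map_mul, map_inv, map_inv, mul_inv_eq_iff_eq_mul, hrel r hr]
        ext <;> simp [Engel.mul_def, Engel.inv_def, add_comm]
    obtain ⟨z', hz', e'⟩ := hx'
    refine ⟨z' + z, ?_, ?_⟩
    · have := Int.natAbs_add_le z' z
      rw [List.length_cons, mul_add_one]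
      omega
    · rw [List.prod_cons, map_mul, e, e']
      ext <;> simp [Engel.mul_def]

theorem exists_word [DecidableEq X] (g : FreeGroup X) :
    ∃ w : Word X, FreeGroup.mk w = g ∧ w.length = g.norm :=
  ⟨g.toWord, FreeGroup.mk_toWord, rfl⟩

theorem norm_pow_le [DecidableEq X] (g : FreeGroup X) (n : ℕ) : (g ^ n).norm ≤ n * g.norm := by
  induction n with
  | zero => simp
  | succ n ih =>
    rw [pow_succ, add_mul, one_mul]
    exact (FreeGroup.norm_mul_le _ _).trans (by omega)

/-- The conjugate of `a` by `b ^ (n ^ 2)` is represented by a word of length `O(n)`. -/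
theorem HeisTriple.isConj {K : ℕ} {a b d : FreeGroup X} (h : HeisTriple R K a b d) (n : ℕ) :
    IsConj (PresentedGroup.mk R a)
      (PresentedGroup.mk R (b ^ n * a ^ n * (b ^ n)⁻¹ * (a ^ n)⁻¹ * a)) := by
  have h1 := (h.swap_pow n n).mk_eq
  have h2 := (h.swap_pow (n * n) 1).mk_eq
  have ha : Commute (PresentedGroup.mk R d) (PresentedGroup.mk R a) := by
    rw [commute_iff_eq, ← map_mul, ← map_mul, h.comm_a.mk_eq]
  have hb : Commute (PresentedGroup.mk R d) (PresentedGroup.mk R b) := by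
    rw [commute_iff_eq, ← map_mul, ← map_mul, h.comm_b.mk_eq]
  simp only [map_mul, map_pow, map_inv, mul_one, pow_one] at h1 h2 ⊢
  generalize PresentedGroup.mk R a = a at *
  generalize PresentedGroup.mk R b = b at *
  generalize PresentedGroup.mk R d = d at *
  refine isConj_iff.2 ⟨b ^ (n * n), ?_⟩
  rw [h1, h2, mul_assoc a, ← (hb.pow_pow (n * n) (n * n)).eq, mul_assoc (a ^ n),
    ← (hb.pow_pow (n * n) n).eq]
  simp only [mul_assoc, mul_inv_cancel, mul_one]
  rw [← mul_assoc (a ^ n), ← (ha.pow_pow (n * n) n).eq, mul_assoc, mul_inv_cancel_left,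
    (ha.pow_left (n * n)).eq]

theorem HeisTriple.pow_le_ann [Finite X] (hR : R.Finite) {K : ℕ} {a b d : FreeGroup X}
    (h : HeisTriple R K a b d) (Φ : PresentedGroup R →* Heis)
    (ha : Φ (PresentedGroup.mk R a) = ⟨1, 0, 0⟩) (hb : Φ (PresentedGroup.mk R b) = ⟨0, 0, 1⟩) :
    Dominated (fun n => n ^ 4) (ann R) := by
  classical
  obtain ⟨φ, M, hφ, hM⟩ := exists_engel_lift hR Φ
  have hφa : φ a = ⟨1, 0, (φ a).r, 0⟩ := by
    have := (hφ a).trans ha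
    simp only [Engel.toHeis, MonoidHom.coe_mk, OneHom.coe_mk, Heis.ext_iff] at this
    ext <;> simp [this]
  have hφb : φ b = ⟨0, 0, (φ b).r, 1⟩ := by
    have := (hφ b).trans hb
    simp only [Engel.toHeis, MonoidHom.coe_mk, OneHom.coe_mk, Heis.ext_iff] at this
    ext <;> simp [this]
  -- `2 * M` comes from n⁴ ≤ 2(n⁴ - n³) ≤ 2M · Ann, and the norms make room for the lengths of the
  -- two words.
  refine ⟨2 * M + 4 * (a.norm + b.norm) + 1, by omega, fun n => ?_⟩
  show n ^ 4 ≤ _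
  -- The defect n⁴ - n³ vanishes at n = 1 and is at least n⁴/2 for n ≥ 2; the additive constant
  -- covers n < 2.
  rcases Nat.lt_or_ge n 2 with hn | hn
  · interval_cases n <;> omega
  obtain ⟨u, hu, hul⟩ := exists_word a
  obtain ⟨v, hv, hvl⟩ := exists_word (b ^ n * a ^ n * (b ^ n)⁻¹ * (a ^ n)⁻¹ * a)
  have hconj : IsConj (val R u) (val R v) := by
    unfold val
    rw [hu, hv]
    exact h.isConj n
  have hlen : u.length + v.length ≤ (2 * M + 4 * (a.norm + b.norm) + 1) * n + n := by
    have h1 := FreeGroup.norm_mul_le (b ^ n * a ^ n * (b ^ n)⁻¹ * (a ^ n)⁻¹) a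
    have h2 := FreeGroup.norm_mul_le (b ^ n * a ^ n * (b ^ n)⁻¹) (a ^ n)⁻¹
    have h3 := FreeGroup.norm_mul_le (b ^ n * a ^ n) (b ^ n)⁻¹
    have h4 := FreeGroup.norm_mul_le (b ^ n) (a ^ n)
    have h5 := norm_pow_le a n
    have h6 := norm_pow_le b n
    rw [FreeGroup.norm_inv_eq] at h2 h3
    have h7 : 2 * a.norm ≤ n * (2 * a.norm) := Nat.le_mul_of_pos_left _ (by omega)
    nlinarith
  have hle : annPair R u v ≤ ann R ((2 * M + 4 * (a.norm + b.norm) + 1) * n + n) :=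
    (isGreatest_ann R _).2 ⟨u, v, hlen, hconj, rfl⟩
  -- Conjugacy makes this set nonempty, so its infimum is attained by some γ and is not the default
  -- value 0.
  have hmem : annPair R u v ∈ {k | ∃ γ : Word X, val R γ * val R u * (val R γ)⁻¹ = val R v ∧
      k = area R (FreeGroup.mk γ * FreeGroup.mk u * (FreeGroup.mk γ)⁻¹ * (FreeGroup.mk v)⁻¹)} := by
    obtain ⟨g, hg⟩ := isConj_iff.1 hconj
    obtain ⟨g, rfl⟩ := PresentedGroup.mk_surjective R g
    obtain ⟨γ, rfl, -⟩ := exists_word g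
    exact Nat.sInf_mem ⟨_, γ, hg, rfl⟩
  obtain ⟨γ, hγ, hk⟩ := hmem
  have hγ' : PresentedGroup.mk R (FreeGroup.mk γ * FreeGroup.mk u * (FreeGroup.mk γ)⁻¹)
      = PresentedGroup.mk R (FreeGroup.mk v) := by
    rw [map_mul, map_mul, map_inv]
    exact hγ
  have hfill := isFilling_area R
    (FreeGroup.mk γ * FreeGroup.mk u * (FreeGroup.mk γ)⁻¹ * (FreeGroup.mk v)⁻¹)
    (by rw [map_mul, map_inv, hγ', mul_inv_cancel])
  rw [← hk] at hfill
  have hbound := hM _ _ hfill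
  have hproj := congrArg Φ hγ'
  rw [← hφ, ← hφ] at hproj
  rw [hu, hv] at hbound hproj
  simp only [map_mul φ, map_inv φ, map_pow φ] at hbound hproj
  rw [hφa, hφb] at hbound hproj
  rw [Engel.conj_defect _ _ _ _ hproj] at hbound
  have h1 : n ^ 4 ≤ 2 * (((n : ℤ) ^ 4 - n ^ 3).natAbs) := by
    have h2 : (2 : ℤ) ≤ n := by exact_mod_cast hn
    have h3 : (0 : ℤ) ≤ n ^ 3 := by positivity
    have h4 : (2 : ℤ) * n ^ 3 ≤ n ^ 4 := by nlinarith
    zify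
    exact le_trans (by linarith) (mul_le_mul_of_nonneg_left (le_abs_self _) zero_le_two)
  calc n ^ 4 ≤ 2 * (M * annPair R u v) := by omega
    _ = 2 * M * annPair R u v := by ring
    _ ≤ (2 * M + 4 * (a.norm + b.norm) + 1) *
        ann R ((2 * M + 4 * (a.norm + b.norm) + 1) * n + n) := by
      gcongr
      omega
    _ ≤ _ := by omega

end Lower

/-! ### The upper bound. -/

section Upper

variable {X : Type*} {R : Set (FreeGroup X)}

theorem annPair_le {u v : Word X} {γ : FreeGroup X} {k : ℕ}
    (h : Within R k (γ * FreeGroup.mk u) (FreeGroup.mk v * γ)) : annPair R u v ≤ k := by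
  classical
  obtain ⟨γ, rfl, -⟩ := exists_word γ
  have h' : Within R k (FreeGroup.mk γ * FreeGroup.mk u * (FreeGroup.mk γ)⁻¹) (FreeGroup.mk v) :=
    h.congr 1 (FreeGroup.mk γ)⁻¹ (by group) (by group)
  refine le_trans (Nat.sInf_le ⟨γ, ?_, rfl⟩) h'.area_le
  have := h'.mk_eq
  rwa [map_mul, map_mul, map_inv] at this

theorem HeisTriple.ann_le_pow [Finite X] {K : ℕ} {a b d : FreeGroup X}
    (h : HeisTriple R K a b d) {B : ℕ} (hB : 1 ≤ B)
    (hgen : ∀ l : X × Bool, ∃ i j k : ℤ, i.natAbs ≤ B ∧ j.natAbs ≤ B ∧ k.natAbs ≤ B ∧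
      Within R K (FreeGroup.mk [l]) (a ^ i * b ^ j * d ^ k))
    (Φ : PresentedGroup R →* Heis) (ha : Φ (PresentedGroup.mk R a) = ⟨1, 0, 0⟩)
    (hb : Φ (PresentedGroup.mk R b) = ⟨0, 0, 1⟩) (hd : Φ (PresentedGroup.mk R d) = ⟨0, 1, 0⟩)
    (n : ℕ) : ann R n ≤ 130 * K * B ^ 4 * n ^ 4 := by
  obtain ⟨u, v, hlen, hconj, e⟩ := (isGreatest_ann R n).1
  rw [e]
  obtain ⟨p, q, z, hp, hq, hz, hu⟩ := h.exists_normalForm hB hgen u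
  obtain ⟨p', q', z', hp', hq', hz', hv⟩ := h.exists_normalForm hB hgen v
  have hval : ∀ x y z : ℤ, Φ (PresentedGroup.mk R (a ^ x * b ^ y * d ^ z)) = ⟨x, z, y⟩ := by
    intro x y z
    rw [← Heis.normalForm, ← ha, ← hb, ← hd]
    simp
  have hc : IsConj (⟨p, z, q⟩ : Heis) ⟨p', z', q'⟩ := by
    rw [← hval, ← hval, ← hu.mk_eq, ← hv.mk_eq]
    exact Φ.map_isConj hconj
  obtain ⟨rfl, rfl, s₀, t₀, h₀⟩ := Heis.eq_of_isConj hc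
  have hun : u.length ≤ n := by omega
  have hvn : v.length ≤ n := by omega
  set m := B * n with hm
  have hum : B * u.length ≤ m := Nat.mul_le_mul_left _ hun
  have hvm : B * v.length ≤ m := Nat.mul_le_mul_left _ hvn
  have hz1 : z.natAbs ≤ m ^ 2 := hz.trans (Nat.pow_le_pow_left hum 2)
  have hz1' : z'.natAbs ≤ m ^ 2 := hz'.trans (Nat.pow_le_pow_left hvm 2)
  have hpm : p.natAbs ≤ m := hp.trans hum
  have hqm : q.natAbs ≤ m := hq.trans hum
  obtain ⟨s, t, hst, hs, ht, htp, hsq⟩ :=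
    exists_bounded_solution (m := m) hpm hqm (by omega) h₀
  -- With γ = a^s b^t, the products γu and vγ have the same normal form, by `hst`.
  have h1 := h.normalForm_mul s t 0 p q z
  have h2 := h.normalForm_mul p q z' s t 0
  rw [show p + s = s + p by ring, show q + t = t + q by ring,
    show z' + 0 + q * s = 0 + z + t * p by linear_combination -hst] at h2
  rw [zpow_zero, mul_one] at h1 h2
  refine (annPair_le (((hu.mul_left (a ^ s * b ^ t)).trans (h1.trans h2.symm)).trans
    (hv.symm.mul_right (a ^ s * b ^ t)))).trans ?_
  rw [Int.natAbs_mul] at htp hsq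
  rw [mul_comm s.natAbs] at hsq
  have hmm : m ≤ m ^ 2 := Nat.le_self_pow (by norm_num) m
  have hpm2 := hpm.trans hmm
  have hqm2 := hqm.trans hmm
  have c1 : t.natAbs * p.natAbs * (t.natAbs + p.natAbs) ≤ 3 * m ^ 2 * (3 * m ^ 2 + m ^ 2) := by
    gcongr
  have c2 : t.natAbs * p.natAbs * q.natAbs ≤ 3 * m ^ 2 * m ^ 2 := by gcongr
  have c3 : z'.natAbs * (s.natAbs + t.natAbs) ≤ m ^ 2 * (3 * m ^ 2 + 3 * m ^ 2) := by gcongr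
  have c4 : q.natAbs * s.natAbs * (q.natAbs + s.natAbs) ≤ 3 * m ^ 2 * (m ^ 2 + 3 * m ^ 2) := by
    gcongr
  have c5 : q.natAbs * s.natAbs * t.natAbs ≤ 3 * m ^ 2 * (3 * m ^ 2) := by gcongr
  have c6 : ∀ k ≤ n, 8 * K * B ^ 3 * k ^ 3 ≤ K * (8 * m ^ 4) := fun k hk =>
    calc 8 * K * B ^ 3 * k ^ 3 ≤ 8 * K * B ^ 3 * n ^ 3 := by gcongr
      _ = K * (8 * m ^ 3) := by rw [hm]; ring
      _ ≤ K * (8 * m ^ 4) := by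
        gcongr 2
        rcases Nat.eq_zero_or_pos m with h0 | h0
        · simp [h0]
        · exact Nat.pow_le_pow_right h0 (by norm_num)
  have c7 := c6 _ hun
  have c8 := c6 _ hvn
  -- Here 51 = 4 · 12 + 3 by `c1`, `c2` and 63 = 6 + 4 · 12 + 9 by `c3`, `c4`, `c5`; each 8 pays for
  -- the normal form of `u` or `v`.
  have e1 : 130 * K * B ^ 4 * n ^ 4 = K * (8 * m ^ 4) + (K * (51 * m ^ 4) + K * (63 * m ^ 4))
      + K * (8 * m ^ 4) := by rw [hm]; ring
  rw [e1]
  gcongr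
  · rw [Int.natAbs_zero, zero_mul, zero_add]
    nlinarith
  · nlinarith

end Upper

/-! ### The standard presentation, and transfer to an arbitrary one. -/

open FreeGroup in
theorem heisenberg_triple :
    HeisTriple heisenbergRels 3 (of HGen.a) (of HGen.b) (of HGen.c)⁻¹ := by
  have rel : ∀ {x y : FreeGroup HGen} (g g' r : FreeGroup HGen), r ∈ heisenbergRels →
      g * r * g' = x → g * 1 * g' = y → Within heisenbergRels 1 x y := fun g g' r hr hx hy =>
    Within.congr (x := r) (y := 1) ⟨1, le_rfl, by simpa using IsFilling.of_mem hr⟩ g g' hx hy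
  have hac : Within heisenbergRels 1 (of HGen.a * of HGen.c) (of HGen.c * of HGen.a) :=
    rel 1 (of HGen.c * of HGen.a) _ (Or.inl rfl) (by group) (by group)
  have hbc : Within heisenbergRels 1 (of HGen.b * of HGen.c) (of HGen.c * of HGen.b) :=
    rel 1 (of HGen.c * of HGen.b) _ (Or.inr (Or.inl rfl)) (by group) (by group)
  have hab : Within heisenbergRels 1 (of HGen.a * of HGen.b)
      (of HGen.c * of HGen.b * of HGen.a) :=
    rel 1 (of HGen.c * of HGen.b * of HGen.a) _ (Or.inr (Or.inr rfl)) (by group) (by group)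
  have hac' := hac.symm.comm_inv_left
  have hbc' := hbc.symm.comm_inv_left
  refine ⟨?_, hac'.mono (by norm_num), hbc'.mono (by norm_num)⟩
  have h1 := (hab.congr (of HGen.c)⁻¹ 1 (x' := (of HGen.c)⁻¹ * of HGen.a * of HGen.b)
    (y' := of HGen.b * of HGen.a) (by group) (by group)).symm
  have h2 := hac'.mul_right (of HGen.b)
  have h3 := hbc'.congr (of HGen.a) 1 (x' := of HGen.a * (of HGen.c)⁻¹ * of HGen.b)
    (y' := of HGen.a * of HGen.b * (of HGen.c)⁻¹) (by group) (by group)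
  exact (h1.trans h2).trans h3

open FreeGroup in
theorem exists_normalForm_heisenberg (g : Heisenberg) : ∃ i j k : ℤ,
    g = PresentedGroup.mk heisenbergRels
      (of HGen.a ^ i * of HGen.b ^ j * (of HGen.c)⁻¹ ^ k) := by
  classical
  obtain ⟨g, rfl⟩ := PresentedGroup.mk_surjective _ g
  obtain ⟨w, rfl, -⟩ := exists_word g
  obtain ⟨i, j, k, -, -, -, h⟩ := heisenberg_triple.exists_normalForm (B := 1) le_rfl (by
    rintro ⟨_ | _ | _, _ | _⟩
    · exact ⟨-1, 0, 0, by simp, by simp, by simp, Within.of_eq (by simp [of, invRev])⟩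
    · exact ⟨1, 0, 0, by simp, by simp, by simp, Within.of_eq (by simp [of])⟩
    · exact ⟨0, -1, 0, by simp, by simp, by simp, Within.of_eq (by simp [of, invRev])⟩
    · exact ⟨0, 1, 0, by simp, by simp, by simp, Within.of_eq (by simp [of])⟩
    · exact ⟨0, 0, 1, by simp, by simp, by simp, Within.of_eq (by simp [of, invRev])⟩
    · exact ⟨0, 0, -1, by simp, by simp, by simp, Within.of_eq (by simp [of])⟩) w
  exact ⟨i, j, k, h.mk_eq⟩

/-- The coordinates of an element of the Heisenberg group. -/
def toHeis : Heisenberg →* Heis :=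
  PresentedGroup.toGroup
    -- The sign at c reflects ba = abc⁻¹: the central generator (0, 1, 0) is the image of c⁻¹.
    (f := fun | HGen.a => ⟨1, 0, 0⟩ | HGen.b => ⟨0, 0, 1⟩ | HGen.c => ⟨0, -1, 0⟩) (by
    rintro r (rfl | rfl | rfl) <;> rfl)

theorem exists_bound {ι : Type*} [Finite ι] {P : ι → ℕ → Prop} (h : ∀ i, ∃ k, P i k)
    (hP : ∀ i j k, j ≤ k → P i j → P i k) : ∃ k, ∀ i, P i k := by
  choose f hf using h
  obtain ⟨k, hk⟩ := (Set.finite_range f).bddAbove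
  exact ⟨k, fun i => hP i _ _ (hk ⟨i, rfl⟩) (hf i)⟩

end AnnularDehn

open AnnularDehn in
/-- For every finite presentation `⟨X ∣ R⟩` of the integral Heisenberg group, in particular for
`⟨a, b, c ∣ [a, c], [b, c], [a, b] c⁻¹⟩`, the annular Dehn function is equivalent to `n ^ 4`. -/
theorem mainTheorem4 {X : Type*} [Finite X] (R : Set (FreeGroup X)) (hR : R.Finite)
    (e : PresentedGroup R ≃* AnnularDehn.Heisenberg) :
    AnnularDehn.Equivalent (AnnularDehn.ann R) (fun n => n ^ 4) := by
  obtain ⟨a, ha⟩ := PresentedGroup.mk_surjective R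
    (e.symm (PresentedGroup.mk heisenbergRels (FreeGroup.of HGen.a)))
  obtain ⟨b, hb⟩ := PresentedGroup.mk_surjective R
    (e.symm (PresentedGroup.mk heisenbergRels (FreeGroup.of HGen.b)))
  obtain ⟨d, hd⟩ := PresentedGroup.mk_surjective R
    (e.symm (PresentedGroup.mk heisenbergRels (FreeGroup.of HGen.c)⁻¹))
  have H := heisenberg_triple
  obtain ⟨k₁, h₁⟩ : ∃ k, Within R k (b * a) (a * b * d) := Within.of_mk_eq (by
    simp only [map_mul, ha, hb, hd]
    simp only [← map_mul, H.swap.mk_eq])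
  obtain ⟨k₂, h₂⟩ : ∃ k, Within R k (d * a) (a * d) := Within.of_mk_eq (by
    simp only [map_mul, ha, hd]
    simp only [← map_mul, H.comm_a.mk_eq])
  obtain ⟨k₃, h₃⟩ : ∃ k, Within R k (d * b) (b * d) := Within.of_mk_eq (by
    simp only [map_mul, hb, hd]
    simp only [← map_mul, H.comm_b.mk_eq])
  obtain ⟨N, hN⟩ : ∃ N : ℕ, ∀ l : X × Bool, ∃ i j k : ℤ, i.natAbs ≤ N ∧ j.natAbs ≤ N ∧
      k.natAbs ≤ N ∧ Within R N (FreeGroup.mk [l]) (a ^ i * b ^ j * d ^ k) := by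
    refine exists_bound (fun l => ?_) ?_
    · obtain ⟨i, j, k, hl⟩ := exists_normalForm_heisenberg
        (e (PresentedGroup.mk R (FreeGroup.mk [l])))
      obtain ⟨c, hc⟩ : ∃ c, Within R c (FreeGroup.mk [l]) (a ^ i * b ^ j * d ^ k) :=
        Within.of_mk_eq (by
          rw [← e.symm_apply_apply (PresentedGroup.mk R (FreeGroup.mk [l])), hl]
          simp only [map_mul, map_zpow, ha, hb, hd])
      exact ⟨i.natAbs + j.natAbs + k.natAbs + c, i, j, k, by omega, by omega, by omega,
        hc.mono (by omega)⟩
    · rintro l N N' hle ⟨i, j, k, hi, hj, hk, hw⟩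
      exact ⟨i, j, k, hi.trans hle, hj.trans hle, hk.trans hle, hw.mono hle⟩
  have hT : HeisTriple R (k₁ + k₂ + k₃ + N) a b d :=
    ⟨h₁.mono (by omega), h₂.mono (by omega), h₃.mono (by omega)⟩
  let Φ : PresentedGroup R →* Heis := toHeis.comp e.toMonoidHom
  have hΦa : Φ (PresentedGroup.mk R a) = ⟨1, 0, 0⟩ := by
    rw [ha]
    exact congrArg toHeis (e.apply_symm_apply _)
  have hΦb : Φ (PresentedGroup.mk R b) = ⟨0, 0, 1⟩ := by
    rw [hb]
    exact congrArg toHeis (e.apply_symm_apply _)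
  have hΦd : Φ (PresentedGroup.mk R d) = ⟨0, 1, 0⟩ := by
    rw [hd]
    exact congrArg toHeis (e.apply_symm_apply _)
  refine ⟨⟨130 * (k₁ + k₂ + k₃ + N) * (N + 1) ^ 4 + 1, by omega, fun n => ?_⟩,
    hT.pow_le_ann hR Φ hΦa hΦb⟩
  have hann := hT.ann_le_pow (B := N + 1) (by omega) (fun l => by
    obtain ⟨i, j, k, hi, hj, hk, hw⟩ := hN l
    exact ⟨i, j, k, by omega, by omega, by omega, hw.mono (by omega)⟩) Φ hΦa hΦb hΦd n
  generalize 130 * (k₁ + k₂ + k₃ + N) * (N + 1) ^ 4 = C at hann ⊢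
  calc ann R n ≤ C * n ^ 4 := hann
    _ ≤ (C + 1) * ((C + 1) * n + n) ^ 4 := by
      gcongr
      · omega
      · omega
    _ ≤ _ := (Nat.le_add_right _ _).trans (Nat.le_add_right _ _)
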